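/- Let $\Sigma$ be a smooth surface diffeomorphic to $\mathbb S^2$, and let $(g(t))_{t\ge 1}$ be a smooth solution on $[1,\infty)\times\Sigma$ of Hamilton's modified Ricci flow $$\frac{\partial}{\partial t}g_{ij}=(r-R_{g(t)})g_{ij}+2D_iD_jf=2M_{ij},\qquad \Delta_{g(t)} f=R_{g(t)}-r,$$ where $g(1)$ has area $4\pi$, $R_{g(t)}$ is the scalar curvature of $g(t)$, $r=r(t)$ its mean value over $(\Sigma,g(t))$ and $f=f(t,x)$ the Ricci potential. Write $|M|=|M|_{g(t)}$, and for a function $F(t,x)$ put $F_*(t)=\inf_{x\in\Sigma}F(t,x)$ and $F^*(t)=\sup_{x\in\Sigma}F(t,x)$. Let $1\le t_0<t_1<\infty$, $0<\alpha<1$, let $\overline R$ be a real function on $[1,\infty)\times\Sigma$, and let $u\in C^{2+\alpha,1+\alpha/2}([t_0,t_1]\times\Sigma)$ be a positive solution on $[t_0,t_1]\times\Sigma$ of $$t(1+t^2)\frac{\partial u}{\partial t}=\frac{u^2\Delta_{g(t)}u}{2}-\frac{u^3}{4}\bigl(R_{g(t)}-t^2\overline R\bigr)+u\left(\frac{1+3t^2}{2}+\frac{t^2(1+t^2)|M|^2_{g(t)}}{4}\right).$$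 Suppose that the functions $$\delta_*(t)=\frac1{t(1+t^2)}\int_1^t\frac{(R_{g(s)}-s^2\overline R)_*(s)}{2}\exp\left(-\int_s^t\frac{\tau(|M|^*(\tau))^2}{2}\,d\tau\right)ds,$$ $$\delta^*(t)=\frac1{t(1+t^2)}\int_1^t\frac{(R_{g(s)}-s^2\overline R)^*(s)}{2}\exp\left(-\int_s^t\frac{\tau(|M|_*(\tau))^2}{2}\,d\tau\right)ds$$ are defined and finite for all $t\in[t_0,\infty)$, that is, $(R_{g(s)}-s^2\overline R)_*(s)$ and $(R_{g(s)}-s^2\overline R)^*(s)$ are finite for almost every $s\ge1$ and the integrals over $[1,t]$ converge absolutely. Then for all $t\in[t_0,t_1]$ and $x\in\Sigma$, $$u^{-2}(t,x)\ge\delta_*(t)+\frac{t_0(1+t_0^2)}{t(1+t^2)}\bigl(u^*(t_0)^{-2}-\delta_*(t_0)\bigr)\exp\left(-\int_{t_0}^t\frac{\tau(|M|^*(\tau))^2}{2}\,d\tau\right)$$ and $$u^{-2}(t,x)\le\delta^*(t)+\frac{t_0(1+t_0^2)}{t(1+t^2)}\bigl(u_*(t_0)^{-2}-\delta^*(t_0)\bigr)\exp\left(-\int_{t_0}^t\frac{\tau(|M|_*(\tau))^2}{2}\,d\tau\right).$$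 -/

import Mathlib

open Set Filter Topology MeasureTheory Manifold
open scoped ContDiff Matrix

noncomputable section

namespace RicciFoliation

/-- The model space of a surface. -/
abbrev Plane : Type := EuclideanSpace ℝ (Fin 2)

/-- The unit sphere in Euclidean 3-space. -/
abbrev TwoSphere : Type := Metric.sphere (0 : EuclideanSpace ℝ (Fin 3)) 1

/-- Partial derivative in the `i`-th coordinate direction. -/
def partialD (i : Fin 2) (F : Plane → ℝ) (y : Plane) : ℝ :=
  fderiv ℝ F y (EuclideanSpace.single i (1 : ℝ))

section Surface

variable {S : Type*} [TopologicalSpace S] [ChartedSpace Plane S] [IsManifold (𝓡 2) ∞ S]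

/-! ### Riemannian geometry of a surface in local coordinates -/

variable (S) in
/-- Smooth Riemannian metrics on the surface `S`. -/
abbrev SurfaceMetric : Type _ :=
  Bundle.ContMDiffRiemannianMetric (𝓡 2) ∞ Plane (fun x : S => TangentSpace (𝓡 2) x)

/-- The local expression of a function on `S` in the chart around `p`. -/
def inChart (p : S) (F : S → ℝ) (y : Plane) : ℝ :=
  F ((extChartAt (𝓡 2) p).symm y)

/-- The coordinate vector field `∂_i` of the chart around `p`, at the point with coordinates `y`. -/
def coordVector (p : S) (i : Fin 2) (y : Plane) :
    TangentSpace (𝓡 2) ((extChartAt (𝓡 2) p).symm y) :=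
  mfderivWithin 𝓘(ℝ, Plane) (𝓡 2) (extChartAt (𝓡 2) p).symm (range (𝓡 2)) y
    (EuclideanSpace.single i (1 : ℝ))

/-- The matrix `g_ij` of the metric in the chart around `p`, at the point with coordinates `y`. -/
def gram (g : SurfaceMetric S) (p : S) (y : Plane) : Matrix (Fin 2) (Fin 2) ℝ :=
  Matrix.of fun i j =>
    g.inner ((extChartAt (𝓡 2) p).symm y) (coordVector p i y) (coordVector p j y)

/-- The Christoffel symbol `Γ^k_ij` in the chart around `p`. -/
def christoffel (g : SurfaceMetric S) (p : S) (k i j : Fin 2) (y : Plane) : ℝ :=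
  (1 / 2) * ∑ l, (gram g p y)⁻¹ k l *
    (partialD i (fun z => gram g p z l j) y + partialD j (fun z => gram g p z i l) y
      - partialD l (fun z => gram g p z i j) y)

/-- The Ricci curvature `R_ij` in the chart around `p`. -/
def ricci (g : SurfaceMetric S) (p : S) (i j : Fin 2) (y : Plane) : ℝ :=
  ∑ k, (partialD k (christoffel g p k i j) y - partialD j (christoffel g p k i k) y
    + ∑ l, (christoffel g p k k l y * christoffel g p l i j y
      - christoffel g p k j l y * christoffel g p l i k y))

/-- The metric at `x`, as a matrix in the coordinates of the chart around `x`. -/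
def gramAt (g : SurfaceMetric S) (x : S) : Matrix (Fin 2) (Fin 2) ℝ :=
  gram g x (extChartAt (𝓡 2) x x)

/-- The scalar curvature `R_g = g^ij R_ij` at `x`. -/
def scalarCurv (g : SurfaceMetric S) (x : S) : ℝ :=
  ∑ i, ∑ j, (gramAt g x)⁻¹ i j * ricci g x i j (extChartAt (𝓡 2) x x)

/-- The Hessian `D_i D_j F = ∂_i ∂_j F - Γ^k_ij ∂_k F` at `x`, in the chart around `x`. -/
def hessAt (g : SurfaceMetric S) (F : S → ℝ) (x : S) : Matrix (Fin 2) (Fin 2) ℝ :=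
  Matrix.of fun i j =>
    partialD i (partialD j (inChart x F)) (extChartAt (𝓡 2) x x)
      - ∑ k, christoffel g x k i j (extChartAt (𝓡 2) x x)
          * partialD k (inChart x F) (extChartAt (𝓡 2) x x)

/-- The Laplace operator `Δ_g F = g^ij D_i D_j F` at `x`. -/
def laplacian (g : SurfaceMetric S) (F : S → ℝ) (x : S) : ℝ :=
  ∑ i, ∑ j, (gramAt g x)⁻¹ i j * hessAt g F x i j

/-- The Riemannian area measure on the domain of the chart around `p`:
the push-forward of `√(det g_ij) dy`. -/
def chartArea [MeasurableSpace S] (g : SurfaceMetric S) (p : S) : Measure S :=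
  Measure.map (extChartAt (𝓡 2) p).symm
    ((volume.restrict (extChartAt (𝓡 2) p).target).withDensity
      fun y => ENNReal.ofReal (Real.sqrt (gram g p y).det))

/-- The Riemannian area measure. The measures `chartArea g p` are the restrictions of the area
measure to the chart domains, which cover `S`, so the area measure is their supremum. -/
def areaMeasure [MeasurableSpace S] (g : SurfaceMetric S) : Measure S :=
  ⨆ p : S, chartArea g p

/-- The mean value `r` of the scalar curvature. -/
def meanScalarCurv [MeasurableSpace S] (g : SurfaceMetric S) : ℝ :=
  ((areaMeasure g).real univ)⁻¹ * ∫ x, scalarCurv g x ∂(areaMeasure g)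

/-! ### Hamilton's modified Ricci flow -/

/-- The tensor `M` of a metric `g` with Ricci potential `f`: `2 M_ij = (r - R) g_ij + 2 D_i D_j f`,
at `x`, in the chart around `x`. -/
def flowTensor [MeasurableSpace S] (g : SurfaceMetric S) (f : S → ℝ) (x : S) :
    Matrix (Fin 2) (Fin 2) ℝ :=
  (1 / 2 : ℝ) • ((meanScalarCurv g - scalarCurv g x) • gramAt g x + (2 : ℝ) • hessAt g f x)

/-- The norm `|M|_g = (g^ik g^jl M_ij M_kl)^(1/2)` at `x`. -/
def flowNorm [MeasurableSpace S] (g : SurfaceMetric S) (f : S → ℝ) (x : S) : ℝ :=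
  Real.sqrt (∑ i, ∑ j, ∑ k, ∑ l, (gramAt g x)⁻¹ i k * (gramAt g x)⁻¹ j l *
    flowTensor g f x i j * flowTensor g f x k l)

/-- `g(t)`, `t ∈ [1, ∞)`, is a solution of Hamilton's modified Ricci flow
`∂_t g_ij = (r - R) g_ij + 2 D_i D_j f = 2 M_ij` with Ricci potential `f`, `Δ f = R - r`. -/
structure IsModifiedRicciFlow [MeasurableSpace S] (g : ℝ → SurfaceMetric S) (f : ℝ → S → ℝ) :
    Prop where
  /-- The metric coefficients are smooth in `(t, y)`. -/
  smooth_metric : ∀ (p : S) (i j : Fin 2),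
    ContDiffOn ℝ ∞ (fun q : ℝ × Plane => gram (g q.1) p q.2 i j)
      (Ici 1 ×ˢ (extChartAt (𝓡 2) p).target)
  smooth_potential : ∀ t, 1 ≤ t → ContMDiff (𝓡 2) 𝓘(ℝ, ℝ) ∞ (f t)
  potential_eq : ∀ t, 1 ≤ t → ∀ x : S,
    laplacian (g t) (f t) x = scalarCurv (g t) x - meanScalarCurv (g t)
  flow_eq : ∀ t, 1 ≤ t → ∀ (x : S) (i j : Fin 2),
    HasDerivWithinAt (fun s => gramAt (g s) x i j)
      (2 * flowTensor (g t) (f t) x i j) (Ici 1) t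

/-! ### Parabolic Hölder spaces -/

/-- `G : I × Ω → ℝ` is locally Hölder continuous in `Ω` with exponent `a` in space and
exponent `b` in time. -/
def ParabolicHolderOn (a b : ℝ) (I : Set ℝ) (Ω : Set Plane) (G : ℝ → Plane → ℝ) : Prop :=
  ∀ K ⊆ Ω, IsCompact K → ∃ C : ℝ, ∀ t ∈ I, ∀ s ∈ I, ∀ y ∈ K, ∀ z ∈ K,
    |G t y - G s z| ≤ C * (dist y z ^ a + |t - s| ^ b)

/-- The parabolic Hölder space `C^{2+α, 1+α/2}(I × S)` for a compact surface `S` and a compact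
interval `I`: in every chart, `∂_t u` and the second space derivatives are `α`-Hölder in space and
`α/2`-Hölder in time, and the first space derivatives are `(1+α)/2`-Hölder in time. -/
structure IsParabolicC2 (α : ℝ) (I : Set ℝ) (u : ℝ → S → ℝ) : Prop where
  contMDiff_space : ∀ t ∈ I, ContMDiff (𝓡 2) 𝓘(ℝ, ℝ) 2 (u t)
  differentiable_time : ∀ x : S, DifferentiableOn ℝ (fun t => u t x) I
  holder_time : ∀ p : S, ParabolicHolderOn α (α / 2) I (extChartAt (𝓡 2) p).target
    (fun t => inChart p (fun x => derivWithin (fun s => u s x) I t))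
  holder_space : ∀ (p : S) (i j : Fin 2),
    ParabolicHolderOn α (α / 2) I (extChartAt (𝓡 2) p).target
      (fun t => partialD i (partialD j (inChart p (u t))))
  holder_gradient : ∀ (p : S) (i : Fin 2), ∀ K ⊆ (extChartAt (𝓡 2) p).target, IsCompact K →
    ∃ C : ℝ, ∀ t ∈ I, ∀ s ∈ I, ∀ y ∈ K,
      |partialD i (inChart p (u t)) y - partialD i (inChart p (u s)) y|
        ≤ C * |t - s| ^ ((1 + α) / 2)

/-! ### The prescribed scalar curvature equation -/

/-- `u` solves, on `I × S`, the equation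
`t(1+t²) ∂_t u = u² Δu / 2 - (u³/4)(R - t² R̄) + u ((1+3t²)/2 + t²(1+t²)|M|²/4)`. -/
def SolvesCurvatureEq [MeasurableSpace S] (g : ℝ → SurfaceMetric S) (f : ℝ → S → ℝ)
    (Rbar : ℝ → S → ℝ) (I : Set ℝ) (u : ℝ → S → ℝ) : Prop :=
  ∀ t ∈ I, ∀ x : S,
    t * (1 + t ^ 2) * derivWithin (fun s => u s x) I t =
      u t x ^ 2 * laplacian (g t) (u t) x / 2
        - u t x ^ 3 / 4 * (scalarCurv (g t) x - t ^ 2 * Rbar t x)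
        + u t x * ((1 + 3 * t ^ 2) / 2 + t ^ 2 * (1 + t ^ 2) * flowNorm (g t) (f t) x ^ 2 / 4)

end Surface

/-! ### Envelopes and the comparison functions -/

section Envelopes

variable {S : Type*}

/-- `F_*(t) = inf_x F(t, x)`. -/
def lowerEnv (F : ℝ → S → ℝ) (t : ℝ) : ℝ := ⨅ x, F t x

/-- `F^*(t) = sup_x F(t, x)`. -/
def upperEnv (F : ℝ → S → ℝ) (t : ℝ) : ℝ := ⨆ x, F t x

/-- `exp(-∫_s^t τ m(τ)² / 2 dτ)`. -/
def decay (m : ℝ → ℝ) (s t : ℝ) : ℝ := Real.exp (-∫ τ in s..t, τ * m τ ^ 2 / 2)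

/-- `δ(t) = (1 / (t(1+t²))) ∫_1^t (h(s)/2) exp(-∫_s^t τ m(τ)²/2 dτ) ds`. -/
def delta (h m : ℝ → ℝ) (t : ℝ) : ℝ :=
  1 / (t * (1 + t ^ 2)) * ∫ s in (1 : ℝ)..t, h s / 2 * decay m s t

/-- The integral in `delta h m t` converges absolutely. -/
def DeltaFinite (h m : ℝ → ℝ) (t : ℝ) : Prop :=
  IntervalIntegrable (fun s => h s / 2 * decay m s t) volume 1 t

end Envelopes

end RicciFoliation

end

/-! The proof is a maximum principle for a rescaled `u⁻²`. Let `m(t)` be the supremum of `|M|` over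
the surface for the lower bound and its infimum for the upper bound, let `A' = t m² / 2`, and put `V
= exp(A) t (1 + t²) u⁻²`. With `F = R - t² R̄`, the equation for `u` becomes `∂_t V = exp(A) (F / 2
- Δu / u + t² (1 + t²) (m² - |M|²) / (2 u²))`; this is `hasDerivWithinAt_rescaled` together with
`rescaled_deriv_eq`. Where `V` is minimal in space, `u` is maximal, so `Δu ≤ 0`. With `m ≥ |M|` this
gives `∂_t V ≥ exp(A) F_* / 2`. Integrating from `t₀` and dividing by `exp(A) t (1 + t²)` gives the
lower bound, in the form computed by `comparison_eq`. The upper bound reverses every sign.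

The envelopes of `F` are only integrable against the weight, so no pointwise ODE comparison in `t`
is available. Instead, `add_integral_le_of_le_deriv_at_min` shows that the spatial minimum of `V` is
Lipschitz in `t` and integrates its almost everywhere derivative. The remaining inputs are a uniform
bound for `∂_t V` (`exists_bound_rescaled_deriv`), the sign of the Laplacian at an extremum, and
continuity of `|M|` in `(t, x)` (`continuousOn_flowNorm`), which makes `A` differentiable. -/

noncomputable section

namespace RicciFoliation

/-! ### The minimum of a family of functions on a compact space -/

/-- A lower bound `h` for the time derivative of `V` at its spatial minima gives, by integration,
a lower bound for `V`. -/
theorem add_integral_le_of_le_deriv_at_min {X : Type*} [TopologicalSpace X] [CompactSpace X]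
    {V V' : ℝ → X → ℝ} {a b C c : ℝ} {h : ℝ → ℝ}
    (hcont : ∀ t ∈ Icc a b, Continuous (V t))
    (hderiv : ∀ t ∈ Icc a b, ∀ x, HasDerivWithinAt (fun s => V s x) (V' t x) (Icc a b) t)
    (hC : ∀ t ∈ Icc a b, ∀ x, |V' t x| ≤ C)
    (hint : ∀ t ∈ Icc a b, IntervalIntegrable h volume a t)
    (hmin : ∀ᵐ t ∂(volume.restrict (Icc a b)), ∀ x, (∀ y, V t x ≤ V t y) → h t ≤ V' t x)
    (hc : ∀ x, c ≤ V a x) {t : ℝ} (ht : t ∈ Icc a b) (x : X) :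
    c + ∫ s in a..t, h s ≤ V t x := by
  have hX : Nonempty X := ⟨x⟩
  have hC0 : 0 ≤ C := (abs_nonneg _).trans (hC t ht x)
  have hab : a ≤ b := ht.1.trans ht.2
  -- The Lipschitz constant is the same for all `y`, so it passes to the infimum over `y`.
  have hlip : ∀ s ∈ Icc a b, ∀ r ∈ Icc a b, ∀ y, V s y ≤ V r y + C * |s - r| := by
    intro s hs r hr y
    have := Convex.norm_image_sub_le_of_norm_hasDerivWithin_le
      (f := fun s => V s y) (fun q hq => hderiv q hq y) (fun q hq => hC q hq y)
      (convex_Icc a b) hr hs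
    rw [Real.norm_eq_abs, Real.norm_eq_abs] at this
    linarith [le_abs_self (V s y - V r y)]
  set μ : ℝ → ℝ := fun t => ⨅ y, V t y with hμ
  have hle : ∀ s ∈ Icc a b, ∀ y, μ s ≤ V s y := fun s hs y =>
    ciInf_le (isCompact_range (hcont s hs)).bddBelow y
  have hex : ∀ s ∈ Icc a b, ∃ y, V s y = μ s := fun s hs => by
    obtain ⟨y, hy⟩ := (isCompact_range (hcont s hs)).sInf_mem (range_nonempty _)
    exact ⟨y, hy⟩
  have hμlip : LipschitzOnWith (Real.toNNReal C) μ (Icc a b) := by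
    refine LipschitzOnWith.of_le_add_mul _ fun s hs r hr => ?_
    obtain ⟨y, hy⟩ := hex r hr
    rw [Real.coe_toNNReal _ hC0, ← hy, Real.dist_eq]
    exact (hle s hs y).trans (hlip s hs r hr y)
  have hac : AbsolutelyContinuousOnInterval μ a t :=
    (hμlip.mono (by rw [uIcc_of_le ht.1]; exact Icc_subset_Icc_right ht.2)
      ).absolutelyContinuousOnInterval
  have hftc := hac.integral_deriv_eq_sub
  have hmono : ∫ s in a..t, h s ≤ ∫ s in a..t, deriv μ s := by
    refine intervalIntegral.integral_mono_ae_restrict ht.1 (hint t ht)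
      hac.intervalIntegrable_deriv ?_
    have hsub : Icc a t ⊆ Icc a b := Icc_subset_Icc_right ht.2
    have h1 := ae_restrict_of_ae_restrict_of_subset hsub hmin
    have h2 : ∀ᵐ s ∂(volume.restrict (Icc a t)), s ∈ Ioo a t := by
      rw [← restrict_Ioo_eq_restrict_Icc]
      exact ae_restrict_mem measurableSet_Ioo
    have h3 := ae_restrict_of_ae (s := Icc a t) hac.ae_differentiableAt
    filter_upwards [h1, h2, h3] with s hs1 hs2 hs3
    have hsI : s ∈ Icc a b := ⟨hs2.1.le, hs2.2.le.trans ht.2⟩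
    have hnhds : Icc a b ∈ 𝓝 s := Icc_mem_nhds hs2.1 (hs2.2.trans_le ht.2)
    obtain ⟨y, hy⟩ := hex s hsI
    have hd : HasDerivAt μ (deriv μ s) s :=
      (hs3 (by rw [uIcc_of_le ht.1]; exact Ioo_subset_Icc_self hs2)).hasDerivAt
    have hd' := ((hderiv s hsI y).hasDerivAt hnhds).sub hd
    -- Hamilton's trick: for a minimizer `y` at time `s`, the difference `V(·, y) - μ` is
    -- nonnegative and vanishes at `s`, so `μ' (s) = ∂_t V(s, y)` wherever `μ` is differentiable.
    have hlm : IsLocalMin ((fun s => V s y) - μ) s := by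
      filter_upwards [hnhds] with r hr
      simp only [Pi.sub_apply, hy, sub_self, sub_nonneg]
      exact hle r hr y
    have h0 := hlm.hasDerivAt_eq_zero hd'
    have := hs1 y (fun z => by rw [hy]; exact hle s hsI z)
    linarith
  have h1 : c ≤ μ a := le_ciInf hc
  linarith [hle t ht x]

/-- An upper bound `h` for the time derivative of `V` at its spatial maxima gives, by integration,
an upper bound for `V`. -/
theorem le_add_integral_of_deriv_at_max_le {X : Type*} [TopologicalSpace X] [CompactSpace X]
    {V V' : ℝ → X → ℝ} {a b C c : ℝ} {h : ℝ → ℝ}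
    (hcont : ∀ t ∈ Icc a b, Continuous (V t))
    (hderiv : ∀ t ∈ Icc a b, ∀ x, HasDerivWithinAt (fun s => V s x) (V' t x) (Icc a b) t)
    (hC : ∀ t ∈ Icc a b, ∀ x, |V' t x| ≤ C)
    (hint : ∀ t ∈ Icc a b, IntervalIntegrable h volume a t)
    (hmax : ∀ᵐ t ∂(volume.restrict (Icc a b)), ∀ x, (∀ y, V t y ≤ V t x) → V' t x ≤ h t)
    (hc : ∀ x, V a x ≤ c) {t : ℝ} (ht : t ∈ Icc a b) (x : X) :
    V t x ≤ c + ∫ s in a..t, h s := by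
  have := add_integral_le_of_le_deriv_at_min (V := fun t x => -V t x) (V' := fun t x => -V' t x)
    (C := C) (c := -c) (h := fun s => -h s) (fun t ht => (hcont t ht).neg)
    (fun t ht x => (hderiv t ht x).fun_neg) (fun t ht x => by simpa using hC t ht x)
    (fun t ht => (hint t ht).neg)
    (by filter_upwards [hmax] with t ht x hx using neg_le_neg (ht x fun y => by simpa using hx y))
    (fun x => neg_le_neg (hc x)) ht x
  rw [intervalIntegral.integral_neg] at this
  linarith

/-! ### The second derivative test -/

/-- If the second derivative were positive, `a` would also be a local minimum, so `φ` would be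
constant near `a` and its second derivative zero. -/
theorem deriv2_nonpos_of_isLocalMax {φ : ℝ → ℝ} {a : ℝ} (hφ : ContinuousAt φ a)
    (hmax : IsLocalMax φ a) : deriv (deriv φ) a ≤ 0 := by
  by_contra! hpos
  have hmin := isLocalMin_of_deriv_deriv_pos hpos hmax.deriv_eq_zero hφ
  have hconst : φ =ᶠ[𝓝 a] fun _ => φ a := by
    filter_upwards [hmin, hmax] with s h1 h2 using le_antisymm h2 h1
  have : deriv (deriv φ) a = 0 := by
    rw [hconst.deriv.deriv_eq]
    simp
  exact hpos.ne' this

theorem eq_sum_smul_single (v : Plane) :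
    v = ∑ i, v i • EuclideanSpace.single i (1 : ℝ) := by
  ext j
  fin_cases j <;> simp [Fin.sum_univ_two]

theorem fderiv_eq_sum_partialD (F : Plane → ℝ) (y v : Plane) :
    fderiv ℝ F y v = ∑ i, v i * partialD i F y := by
  conv_lhs => rw [eq_sum_smul_single v]
  simp [partialD]

theorem contDiffAt_partialD {F : Plane → ℝ} {y : Plane} (hF : ContDiffAt ℝ 2 F y) (i : Fin 2) :
    ContDiffAt ℝ 1 (partialD i F) y :=
  (hF.fderiv_right (m := 1) (by norm_num)).clm_apply contDiffAt_const

theorem partialD_eq_zero_of_isLocalMax {F : Plane → ℝ} {y : Plane} (hmax : IsLocalMax F y)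
    (i : Fin 2) : partialD i F y = 0 := by
  simp [partialD, hmax.fderiv_eq_zero]

/-- Restricting `F` to the line through `y` in direction `v` reduces this to one variable. -/
theorem sum_partialD_partialD_nonpos {F : Plane → ℝ} {y : Plane} (hF : ContDiffAt ℝ 2 F y)
    (hmax : IsLocalMax F y) (v : Plane) :
    ∑ i, ∑ j, v i * v j * partialD i (partialD j F) y ≤ 0 := by
  set γ : ℝ → Plane := fun s => y + s • v with hγ
  have hγ0 : γ 0 = y := by simp [hγ]
  have hγd : ∀ s, HasDerivAt γ v s := fun s => by
    have := ((hasDerivAt_id s).smul_const v).const_add y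
    rwa [one_smul] at this
  have hγc : ContinuousAt γ 0 := (hγd 0).continuousAt
  have hγt : Tendsto γ (𝓝 0) (𝓝 y) := by simpa [hγ0] using hγc.tendsto
  have hφ : ContinuousAt (F ∘ γ) 0 :=
    ContinuousAt.comp (by rw [hγ0]; exact hF.continuousAt) hγc
  have hφmax : IsLocalMax (F ∘ γ) 0 := by
    filter_upwards [hγt hmax] with s hs
    simpa [hγ0] using hs
  have hφ1 : deriv (F ∘ γ) =ᶠ[𝓝 0] fun s => ∑ j, v j * partialD j F (γ s) := by
    filter_upwards [hγt (hF.eventually (by simp))] with s (hs : ContDiffAt ℝ 2 F (γ s))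
    rw [← fderiv_eq_sum_partialD]
    exact ((hs.differentiableAt (by norm_num)).hasFDerivAt.comp_hasDerivAt s (hγd s)).deriv
  have hφ2 : deriv (deriv (F ∘ γ)) 0
      = ∑ i, ∑ j, v i * v j * partialD i (partialD j F) y := by
    rw [hφ1.deriv_eq, Finset.sum_comm]
    refine HasDerivAt.deriv (HasDerivAt.fun_sum fun j _ => ?_)
    have hd : HasFDerivAt (partialD j F) (fderiv ℝ (partialD j F) y) (γ 0) := by
      rw [hγ0]
      exact ((contDiffAt_partialD hF j).differentiableAt (by norm_num)).hasFDerivAt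
    have := (hd.comp_hasDerivAt 0 (hγd 0)).const_mul (v j)
    rw [fderiv_eq_sum_partialD, Finset.mul_sum] at this
    refine this.congr_deriv (Finset.sum_congr rfl fun i _ => by ring)
  rw [← hφ2]
  exact deriv2_nonpos_of_isLocalMax hφ hφmax

/-- The contraction of a positive semidefinite matrix with a negative semidefinite form. -/
theorem sum_mul_nonpos_of_posSemidef {P H : Matrix (Fin 2) (Fin 2) ℝ} (hP : P.PosSemidef)
    (hH : ∀ v : Plane, ∑ i, ∑ j, v i * v j * H i j ≤ 0) :
    ∑ i, ∑ j, P i j * H i j ≤ 0 := by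
  -- Writing `P` as a sum of rank-one matrices `w wᵀ` turns the contraction into a sum of values of
  -- the form `H`.
  obtain ⟨n, w, rfl⟩ := Matrix.posSemidef_iff_eq_sum_vecMulVec.mp hP
  have hrw : ∑ i, ∑ j, (∑ k, Matrix.vecMulVec (w k) (star (w k))) i j * H i j
      = ∑ k, ∑ i, ∑ j, w k i * w k j * H i j := by
    simp only [Matrix.sum_apply, Matrix.vecMulVec_apply, star_trivial,
      Finset.sum_mul]
    rw [Finset.sum_comm]
    simp only [Fin.sum_univ_two, Finset.sum_add_distrib]
    ring
  rw [hrw]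
  exact Finset.sum_nonpos fun k _ => hH (WithLp.toLp 2 (w k))

section Surface

variable {S : Type*} [TopologicalSpace S] [ChartedSpace Plane S] [IsManifold (𝓡 2) ∞ S]

/-! ### The metric in local coordinates -/

/-- The derivative at the point `q` of the parametrization given by the chart around `p`. -/
def frameMap (p q : S) : Plane →L[ℝ] Plane :=
  mfderivWithin 𝓘(ℝ, Plane) (𝓡 2) (extChartAt (𝓡 2) p).symm (range (𝓡 2)) (extChartAt (𝓡 2) p q)

/-- The inner product of a metric on the tangent space at `q`, as a bilinear form on the plane. -/
def metricForm (g : SurfaceMetric S) (q : S) : Plane →L[ℝ] Plane →L[ℝ] ℝ := g.inner q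

/-- The base point `φ⁻¹ (φ q)` equals `q` only propositionally, and the tangent space depends on it.
Since `metricForm` has a fixed type, the point can be rewritten. -/
theorem gram_eq_metricForm (g : SurfaceMetric S) {p q : S}
    (hq : q ∈ (extChartAt (𝓡 2) p).source) (i j : Fin 2) :
    gram g p (extChartAt (𝓡 2) p q) i j
      = metricForm g q (frameMap p q (EuclideanSpace.single i (1 : ℝ)))
          (frameMap p q (EuclideanSpace.single j (1 : ℝ))) := by
  have h : metricForm g ((extChartAt (𝓡 2) p).symm (extChartAt (𝓡 2) p q)) = metricForm g q := by
    rw [(extChartAt (𝓡 2) p).left_inv hq]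
  rw [← h]
  rfl

theorem frameMap_isInvertible {p q : S} (hq : q ∈ (extChartAt (𝓡 2) p).source) :
    (frameMap p q).IsInvertible := by
  exact isInvertible_mfderivWithin_extChartAt_symm ((extChartAt (𝓡 2) p).map_source hq)

theorem metricForm_frameMap (g : SurfaceMetric S) {p q : S}
    (hq : q ∈ (extChartAt (𝓡 2) p).source) (v w : Plane) :
    metricForm g q (frameMap p q v) (frameMap p q w)
      = ∑ i, ∑ j, v i * gram g p (extChartAt (𝓡 2) p q) i j * w j := by
  conv_lhs => rw [eq_sum_smul_single v, eq_sum_smul_single w]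
  simp only [gram_eq_metricForm g hq, Fin.sum_univ_two, map_add, map_smul,
    add_apply, smul_apply, smul_eq_mul]
  ring

theorem gram_posDef (g : SurfaceMetric S) {p q : S} (hq : q ∈ (extChartAt (𝓡 2) p).source) :
    (gram g p (extChartAt (𝓡 2) p q)).PosDef := by
  refine Matrix.PosDef.of_dotProduct_mulVec_pos ?_ fun v hv => ?_
  · ext i j
    rw [Matrix.conjTranspose_apply, star_trivial, gram_eq_metricForm g hq,
      gram_eq_metricForm g hq]
    exact g.symm q _ _
  · have h := metricForm_frameMap g hq (WithLp.toLp 2 v) (WithLp.toLp 2 v)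
    have hne : frameMap p q (WithLp.toLp 2 v) ≠ 0 := by
      intro h0
      have := (frameMap_isInvertible hq).injective (h0.trans (map_zero _).symm)
      exact hv (by simpa using congrArg (WithLp.ofLp) this)
    have hpos : 0 < metricForm g q (frameMap p q (WithLp.toLp 2 v))
        (frameMap p q (WithLp.toLp 2 v)) := g.pos q _ hne
    rw [h] at hpos
    simp only [dotProduct, Matrix.mulVec, Fin.sum_univ_two, Pi.star_apply, star_trivial] at hpos ⊢
    linarith

theorem gramAt_posDef (g : SurfaceMetric S) (x : S) : (gramAt g x).PosDef :=
  gram_posDef g (mem_extChartAt_source x)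

/-- `A` is the change of frame between the charts around `x` and `p`. It does not depend on the
metric, so a single `A` serves all times and commutes with `∂_t`. -/
theorem exists_gramAt_eq {p x : S} (hx : x ∈ (extChartAt (𝓡 2) p).source) :
    ∃ A : Matrix (Fin 2) (Fin 2) ℝ, ∀ g : SurfaceMetric S,
      gramAt g x = Aᵀ * gram g p (extChartAt (𝓡 2) p x) * A := by
  have hinv := (frameMap_isInvertible hx).bijective.surjective
  choose L hL using fun i => hinv (frameMap x x (EuclideanSpace.single i (1 : ℝ)))
  refine ⟨Matrix.of fun a i => L i a, fun g => ?_⟩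
  ext i j
  rw [gramAt, gram_eq_metricForm g (mem_extChartAt_source x), ← hL, ← hL,
    metricForm_frameMap g hx]
  simp only [Matrix.mul_apply, Matrix.transpose_apply, Matrix.of_apply, Fin.sum_univ_two]
  ring

/-! ### The Laplace operator at a maximum -/

/-- At a maximum the first derivatives vanish, so the Christoffel terms drop out and the Hessian is
the matrix of second partial derivatives, contracted with a positive definite inverse metric. -/
theorem laplacian_nonpos_of_isMax (g : SurfaceMetric S) {F : S → ℝ}
    (hF : ContMDiff (𝓡 2) 𝓘(ℝ, ℝ) 2 F) {x : S} (hmax : ∀ y, F y ≤ F x) :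
    laplacian g F x ≤ 0 := by
  set y := extChartAt (𝓡 2) x x with hy
  have hloc : IsLocalMax (inChart x F) y := by
    refine Eventually.of_forall fun z => ?_
    have : inChart x F y = F x := by
      rw [inChart, hy, (extChartAt (𝓡 2) x).left_inv (mem_extChartAt_source x)]
    rw [this]
    exact hmax _
  have hsm : ContDiffAt ℝ 2 (inChart x F) y := by
    have h1 : ContMDiffOn 𝓘(ℝ, Plane) 𝓘(ℝ, ℝ) 2 (inChart x F) (extChartAt (𝓡 2) x).target :=
      hF.comp_contMDiffOn (contMDiffOn_extChartAt_symm x)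
    exact h1.contDiffOn.contDiffAt (extChartAt_target_mem_nhds x)
  refine sum_mul_nonpos_of_posSemidef (gramAt_posDef g x).inv.posSemidef fun v => ?_
  have h := sum_partialD_partialD_nonpos hsm hloc v
  simpa only [hessAt, Matrix.of_apply, ← hy, partialD_eq_zero_of_isLocalMax hloc, mul_zero,
    Finset.sum_const_zero, sub_zero] using h

theorem laplacian_nonneg_of_isMin (g : SurfaceMetric S) {F : S → ℝ}
    (hF : ContMDiff (𝓡 2) 𝓘(ℝ, ℝ) 2 F) {x : S} (hmin : ∀ y, F x ≤ F y) :
    0 ≤ laplacian g F x := by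
  have hneg : ∀ i (G : Plane → ℝ), partialD i (fun z => -G z) = fun z => -partialD i G z := by
    intro i G
    ext z
    simp [partialD, fderiv_fun_neg]
  have h := laplacian_nonpos_of_isMax g (F := fun z => -F z) (contDiff_neg.contMDiff.comp hF)
    (x := x) (fun y => neg_le_neg (hmin y))
  have hin : inChart x (fun z => -F z) = fun z => -inChart x F z := rfl
  have : laplacian g (fun z => -F z) x = -laplacian g F x := by
    simp only [laplacian, hessAt, hin, hneg, Matrix.of_apply, Fin.sum_univ_two]
    ring
  linarith

end Surface

/-! ### The norm of the flow tensor -/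

/-- The squared norm of the bilinear form `M` with respect to the inner product `G`. -/
def formNormSq (G M : Matrix (Fin 2) (Fin 2) ℝ) : ℝ :=
  ∑ i, ∑ j, ∑ k, ∑ l, G⁻¹ i k * G⁻¹ j l * M i j * M k l

theorem formNormSq_eq_trace (G M : Matrix (Fin 2) (Fin 2) ℝ) :
    formNormSq G M = (G⁻¹ * M * G⁻¹ᵀ * Mᵀ).trace := by
  simp only [formNormSq, Matrix.trace, Matrix.diag_apply, Matrix.mul_apply,
    Matrix.transpose_apply, Fin.sum_univ_two]
  ring

/-- Invariance under change of frame: in the trace form the factors `A` and `A⁻¹` cancel cyclically.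
-/
theorem formNormSq_congr {A : Matrix (Fin 2) (Fin 2) ℝ} (hA : IsUnit A.det)
    (G M : Matrix (Fin 2) (Fin 2) ℝ) :
    formNormSq (Aᵀ * G * A) (Aᵀ * M * A) = formNormSq G M := by
  have h1 : A * A⁻¹ = 1 := Matrix.mul_nonsing_inv A hA
  have h2 : A⁻¹ᵀ * Aᵀ = 1 := by rw [← Matrix.transpose_mul, h1, Matrix.transpose_one]
  rw [formNormSq_eq_trace, formNormSq_eq_trace, Matrix.mul_inv_rev, Matrix.mul_inv_rev,
    ← Matrix.transpose_nonsing_inv]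
  simp only [Matrix.transpose_mul, Matrix.transpose_transpose]
  calc (A⁻¹ * (G⁻¹ * A⁻¹ᵀ) * (Aᵀ * M * A) * (A⁻¹ * G⁻¹ᵀ * A⁻¹ᵀ) * (Aᵀ * (Mᵀ * A))).trace
      = (A⁻¹ * (G⁻¹ * (A⁻¹ᵀ * Aᵀ) * M * (A * A⁻¹) * G⁻¹ᵀ * (A⁻¹ᵀ * Aᵀ) * Mᵀ * A)).trace := by
        simp only [Matrix.mul_assoc]
    _ = (G⁻¹ * M * G⁻¹ᵀ * Mᵀ * (A * A⁻¹)).trace := by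
        rw [Matrix.trace_mul_comm, h1, h2]
        simp only [Matrix.mul_one, Matrix.mul_assoc, h1]
    _ = (G⁻¹ * M * G⁻¹ᵀ * Mᵀ).trace := by rw [h1, Matrix.mul_one]

/-! ### Joint continuity of `|M|` along the flow -/

section Surface

variable {S : Type*} [TopologicalSpace S] [ChartedSpace Plane S] [IsManifold (𝓡 2) ∞ S]

/-- The time derivative of the metric coefficients in the chart around `p`. -/
def gramDeriv (g : ℝ → SurfaceMetric S) (p : S) (t : ℝ) (y : Plane) :
    Matrix (Fin 2) (Fin 2) ℝ :=
  Matrix.of fun i j => derivWithin (fun s => gram (g s) p y i j) (Ici 1) t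

variable [MeasurableSpace S] {g : ℝ → SurfaceMetric S} {f : ℝ → S → ℝ}

namespace IsModifiedRicciFlow

theorem hasDerivWithinAt_gram (hflow : IsModifiedRicciFlow g f) {p : S} {t : ℝ} {y : Plane}
    (ht : 1 ≤ t) (hy : y ∈ (extChartAt (𝓡 2) p).target) (i j : Fin 2) :
    HasDerivWithinAt (fun s => gram (g s) p y i j)
      (fderivWithin ℝ (fun q : ℝ × Plane => gram (g q.1) p q.2 i j)
        (Ici 1 ×ˢ (extChartAt (𝓡 2) p).target) (t, y) (1, 0)) (Ici 1) t := by
  have h1 := ((hflow.smooth_metric p i j).differentiableOn (by norm_num) (t, y)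
    ⟨ht, hy⟩).hasFDerivWithinAt
  have h2 : HasDerivWithinAt (fun s : ℝ => (s, y)) ((1 : ℝ), (0 : Plane)) (Ici 1) t :=
    (hasDerivWithinAt_id t _).prodMk (hasDerivWithinAt_const t _ y)
  have hmaps : MapsTo (fun s : ℝ => (s, y)) (Ici 1) (Ici 1 ×ˢ (extChartAt (𝓡 2) p).target) :=
    fun s hs => ⟨hs, hy⟩
  exact h1.comp_hasDerivWithinAt t h2 hmaps

theorem continuousOn_gramDeriv (hflow : IsModifiedRicciFlow g f) (p : S) (i j : Fin 2) :
    ContinuousOn (fun q : ℝ × Plane => gramDeriv g p q.1 q.2 i j)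
      (Ici 1 ×ˢ (extChartAt (𝓡 2) p).target) := by
  have hu : UniqueDiffOn ℝ (Ici (1 : ℝ) ×ˢ (extChartAt (𝓡 2) p).target) :=
    (uniqueDiffOn_Ici 1).prod (isOpen_extChartAt_target p).uniqueDiffOn
  have h := ((hflow.smooth_metric p i j).continuousOn_fderivWithin hu (by norm_num)).clm_apply
    (continuousOn_const (c := ((1 : ℝ), (0 : Plane))))
  refine h.congr fun q hq => ?_
  exact (hflow.hasDerivWithinAt_gram hq.1 hq.2 i j).derivWithin (uniqueDiffOn_Ici 1 q.1 hq.1)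

/-- The flow equation is stated in the chart centred at `x`, which varies with `x`. Uniqueness of
the time derivative carries `M = ½ ∂_t g` over to the fixed chart around `p`. -/
theorem flowTensor_eq (hflow : IsModifiedRicciFlow g f) {p x : S} {t : ℝ} (ht : 1 ≤ t)
    (hx : x ∈ (extChartAt (𝓡 2) p).source) {A : Matrix (Fin 2) (Fin 2) ℝ}
    (hA : ∀ g : SurfaceMetric S, gramAt g x = Aᵀ * gram g p (extChartAt (𝓡 2) p x) * A) :
    flowTensor (g t) (f t) x
      = Aᵀ * ((1 / 2 : ℝ) • gramDeriv g p t (extChartAt (𝓡 2) p x)) * A := by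
  ext i j
  have hd : ∀ a b, HasDerivWithinAt (fun s => gram (g s) p (extChartAt (𝓡 2) p x) a b)
      (gramDeriv g p t (extChartAt (𝓡 2) p x) a b) (Ici 1) t := fun a b =>
    (hflow.hasDerivWithinAt_gram ht
      ((extChartAt (𝓡 2) p).map_source hx) a b).differentiableWithinAt.hasDerivWithinAt
  have h1 := hflow.flow_eq t ht x i j
  have h2 : HasDerivWithinAt (fun s => gramAt (g s) x i j)
      ((Aᵀ * gramDeriv g p t (extChartAt (𝓡 2) p x) * A) i j) (Ici 1) t := by
    simp only [hA, Matrix.mul_apply, Matrix.transpose_apply]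
    exact HasDerivWithinAt.fun_sum fun b _ => (HasDerivWithinAt.fun_sum fun a _ =>
      (hd a b).const_mul (A a i)).mul_const (A b j)
  have h3 := (uniqueDiffOn_Ici 1 t ht).eq_deriv _ h1 h2
  rw [Matrix.mul_smul, Matrix.smul_mul, Matrix.smul_apply, ← h3, smul_eq_mul]
  ring

theorem flowNorm_eq (hflow : IsModifiedRicciFlow g f) {p x : S} {t : ℝ} (ht : 1 ≤ t)
    (hx : x ∈ (extChartAt (𝓡 2) p).source) :
    flowNorm (g t) (f t) x = Real.sqrt (formNormSq (gram (g t) p (extChartAt (𝓡 2) p x))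
      ((1 / 2 : ℝ) • gramDeriv g p t (extChartAt (𝓡 2) p x))) := by
  obtain ⟨A, hA⟩ := exists_gramAt_eq hx
  have hdet : IsUnit A.det := by
    have h := (Matrix.isUnit_iff_isUnit_det _).mp (gramAt_posDef (g t) x).isUnit
    rw [hA, Matrix.det_mul] at h
    exact isUnit_of_mul_isUnit_right h
  rw [← formNormSq_congr hdet, ← hA, ← hflow.flowTensor_eq ht hx hA]
  rfl

/-- The potential `f` and the mean curvature `r` come with no assumed regularity in `t`. Continuity
is therefore read off from `½ ∂_t g`, which is continuous because the metric coefficients are smooth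
in `(t, y)`. -/
theorem continuousOn_flowNorm (hflow : IsModifiedRicciFlow g f) :
    ContinuousOn (fun q : ℝ × S => flowNorm (g q.1) (f q.1) q.2) (Ici 1 ×ˢ univ) := by
  rintro ⟨t, p⟩ ⟨ht, -⟩
  have hG : ∀ i j, ContinuousOn (fun q : ℝ × Plane => gram (g q.1) p q.2 i j)
      (Ici 1 ×ˢ (extChartAt (𝓡 2) p).target) := fun i j =>
    (hflow.smooth_metric p i j).continuousOn
  have hGm : ContinuousOn (fun q : ℝ × Plane => gram (g q.1) p q.2)
      (Ici 1 ×ˢ (extChartAt (𝓡 2) p).target) :=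
    continuousOn_pi.mpr fun i => continuousOn_pi.mpr fun j => hG i j
  have hinv : ∀ i j, ContinuousOn (fun q : ℝ × Plane => (gram (g q.1) p q.2)⁻¹ i j)
      (Ici 1 ×ˢ (extChartAt (𝓡 2) p).target) := fun i j => by
    have hdet : ∀ q ∈ Ici (1 : ℝ) ×ˢ (extChartAt (𝓡 2) p).target,
        (gram (g q.1) p q.2).det ≠ 0 := fun q hq => by
      have h := (gram_posDef (g q.1) ((extChartAt (𝓡 2) p).map_target hq.2)).det_pos.ne'
      rwa [(extChartAt (𝓡 2) p).right_inv hq.2] at h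
    have hadj : ContinuousOn (fun q : ℝ × Plane => (gram (g q.1) p q.2).adjugate i j)
        (Ici 1 ×ˢ (extChartAt (𝓡 2) p).target) :=
      ((continuous_id.matrix_adjugate.matrix_elem i j).comp_continuousOn hGm)
    have hd : ContinuousOn (fun q : ℝ × Plane => (gram (g q.1) p q.2).det)
        (Ici 1 ×ˢ (extChartAt (𝓡 2) p).target) :=
      continuous_id.matrix_det.comp_continuousOn hGm
    refine ((hd.inv₀ hdet).mul hadj).congr fun q _ => ?_
    simp [Matrix.inv_def, Ring.inverse_eq_inv']
  have hN : ContinuousOn (fun q : ℝ × Plane => Real.sqrt (formNormSq (gram (g q.1) p q.2)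
      ((1 / 2 : ℝ) • gramDeriv g p q.1 q.2))) (Ici 1 ×ˢ (extChartAt (𝓡 2) p).target) := by
    refine Real.continuous_sqrt.comp_continuousOn ?_
    simp only [formNormSq, Matrix.smul_apply, smul_eq_mul]
    refine continuousOn_finsetSum _ fun i _ => continuousOn_finsetSum _ fun j _ =>
      continuousOn_finsetSum _ fun k _ => continuousOn_finsetSum _ fun l _ => ?_
    exact (((hinv i k).mul (hinv j l)).mul
      (continuousOn_const.mul (hflow.continuousOn_gramDeriv p i j))).mul
      (continuousOn_const.mul (hflow.continuousOn_gramDeriv p k l))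
  have hφ : ContinuousOn (fun q : ℝ × S => (q.1, extChartAt (𝓡 2) p q.2))
      (Ici 1 ×ˢ (extChartAt (𝓡 2) p).source) :=
    continuousOn_fst.prodMk ((continuousOn_extChartAt p).comp continuousOn_snd fun q hq => hq.2)
  have hc : ContinuousOn (fun q : ℝ × S => flowNorm (g q.1) (f q.1) q.2)
      (Ici 1 ×ˢ (extChartAt (𝓡 2) p).source) :=
    (hN.comp hφ fun q hq => ⟨hq.1, (extChartAt (𝓡 2) p).map_source hq.2⟩).congr
      fun q hq => hflow.flowNorm_eq hq.1 hq.2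
  refine (hc (t, p) ⟨ht, mem_extChartAt_source p⟩).mono_of_mem_nhdsWithin ?_
  rw [nhdsWithin_prod_eq, nhdsWithin_univ]
  exact prod_mem_prod self_mem_nhdsWithin (extChartAt_source_mem_nhds p)

end IsModifiedRicciFlow

end Surface

/-! ### Envelopes -/

section Envelopes

variable {S : Type*} [TopologicalSpace S] [CompactSpace S] {m : ℝ → S → ℝ} {I : Set ℝ}

theorem continuousOn_upperEnv (hm : ContinuousOn (Function.uncurry m) (I ×ˢ univ)) :
    ContinuousOn (upperEnv m) I := by
  rw [continuousOn_iff_continuous_domRestrict]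
  have h : Continuous ↿(fun (t : I) (x : S) => m t x) :=
    hm.comp_continuous (f := fun q : I × S => ((q.1 : ℝ), q.2)) (by fun_prop)
      fun q => ⟨q.1.2, mem_univ _⟩
  simpa [upperEnv, sSup_range, Set.domRestrict_def] using isCompact_univ.continuous_sSup h

theorem continuousOn_lowerEnv (hm : ContinuousOn (Function.uncurry m) (I ×ˢ univ)) :
    ContinuousOn (lowerEnv m) I := by
  rw [continuousOn_iff_continuous_domRestrict]
  have h : Continuous ↿(fun (t : I) (x : S) => m t x) :=
    hm.comp_continuous (f := fun q : I × S => ((q.1 : ℝ), q.2)) (by fun_prop)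
      fun q => ⟨q.1.2, mem_univ _⟩
  simpa [lowerEnv, sInf_range, Set.domRestrict_def] using isCompact_univ.continuous_sInf h

end Envelopes

/-! ### Regularity of the solution -/

section Regularity

variable {S : Type*} [TopologicalSpace S] [ChartedSpace Plane S] [CompactSpace S]
  {α t₀ t₁ : ℝ} {u : ℝ → S → ℝ}

namespace IsParabolicC2

theorem exists_bound_derivWithin (hu : IsParabolicC2 α (Icc t₀ t₁) u) (hα : 0 < α)
    (h01 : t₀ ≤ t₁) :
    ∃ C, ∀ t ∈ Icc t₀ t₁, ∀ x, |derivWithin (fun s => u s x) (Icc t₀ t₁) t| ≤ C := by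
  have key : ∃ C, ∀ t ∈ Icc t₀ t₁, ∀ x ∈ (univ : Set S),
      |derivWithin (fun s => u s x) (Icc t₀ t₁) t| ≤ C := by
    -- The Hölder condition bounds the time derivative only on compact pieces of a chart; finitely
    -- many such pieces cover `S`.
    refine isCompact_univ.induction_on
      (p := fun N : Set S => ∃ C, ∀ t ∈ Icc t₀ t₁, ∀ x ∈ N,
        |derivWithin (fun s => u s x) (Icc t₀ t₁) t| ≤ C) ⟨0, by simp⟩ ?_ ?_ ?_
    · rintro N N' hN ⟨C, hC⟩
      exact ⟨C, fun t ht x hx => hC t ht x (hN hx)⟩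
    · rintro N N' ⟨C, hC⟩ ⟨C', hC'⟩
      refine ⟨max C C', fun t ht x hx => ?_⟩
      rcases hx with hx | hx
      · exact (hC t ht x hx).trans (le_max_left _ _)
      · exact (hC' t ht x hx).trans (le_max_right _ _)
    · intro p _
      obtain ⟨K, hK, hpK, hKt⟩ := exists_compact_subset (isOpen_extChartAt_target (I := 𝓡 2) p)
        (mem_extChartAt_target (I := 𝓡 2) p)
      obtain ⟨C, hC⟩ := hu.holder_time p K hKt hK
      set G : ℝ → Plane → ℝ := fun t =>
        inChart p (fun x => derivWithin (fun s => u s x) (Icc t₀ t₁) t) with hG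
      set y₀ := extChartAt (𝓡 2) p p
      have hN : (extChartAt (𝓡 2) p).source ∩ extChartAt (𝓡 2) p ⁻¹' K ∈ 𝓝 p :=
        inter_mem (extChartAt_source_mem_nhds p)
          ((continuousAt_extChartAt p).preimage_mem_nhds (mem_interior_iff_mem_nhds.mp hpK))
      refine ⟨_, mem_nhdsWithin_of_mem_nhds hN,
        |G t₀ y₀| + |C| * (Metric.diam K ^ α + (t₁ - t₀) ^ (α / 2)), fun t ht x hx => ?_⟩
      have hval : derivWithin (fun s => u s x) (Icc t₀ t₁) t = G t (extChartAt (𝓡 2) p x) := by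
        simp only [hG, inChart]
        rw [(extChartAt (𝓡 2) p).left_inv hx.1]
      rw [hval]
      have h1 := hC t ht t₀ ⟨le_rfl, h01⟩ _ hx.2 y₀ (interior_subset hpK)
      have h2 : dist (extChartAt (𝓡 2) p x) y₀ ^ α ≤ Metric.diam K ^ α :=
        Real.rpow_le_rpow dist_nonneg
          (Metric.dist_le_diam_of_mem hK.isBounded hx.2 (interior_subset hpK)) hα.le
      have h3 : |t - t₀| ^ (α / 2) ≤ (t₁ - t₀) ^ (α / 2) := by
        refine Real.rpow_le_rpow (abs_nonneg _) ?_ (by linarith)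
        rw [abs_of_nonneg (by linarith [ht.1])]
        linarith [ht.2]
      have h4 : C * (dist (extChartAt (𝓡 2) p x) y₀ ^ α + |t - t₀| ^ (α / 2))
          ≤ |C| * (Metric.diam K ^ α + (t₁ - t₀) ^ (α / 2)) :=
        mul_le_mul (le_abs_self C) (add_le_add h2 h3) (by positivity) (abs_nonneg C)
      have h5 := abs_sub_abs_le_abs_sub (G t (extChartAt (𝓡 2) p x)) (G t₀ y₀)
      simp only [hG] at *
      linarith
  obtain ⟨C, hC⟩ := key
  exact ⟨C, fun t ht x => hC t ht x (mem_univ x)⟩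

/-- Continuity in `x` for each `t`, together with a Lipschitz bound in `t` uniform in `x`, gives
joint continuity. -/
theorem continuousOn_uncurry (hu : IsParabolicC2 α (Icc t₀ t₁) u) (hα : 0 < α)
    (h01 : t₀ ≤ t₁) : ContinuousOn (Function.uncurry u) (Icc t₀ t₁ ×ˢ univ) := by
  obtain ⟨C, hC⟩ := hu.exists_bound_derivWithin hα h01
  refine continuousOn_prod_of_continuousOn_lipschitzOnWith _ C.toNNReal
    (fun t ht => (hu.contMDiff_space t ht).continuous.continuousOn) fun x _ => ?_
  refine (convex_Icc t₀ t₁).lipschitzOnWith_of_nnnorm_hasDerivWithin_le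
    (fun t ht => (hu.differentiable_time x t ht).hasDerivWithinAt) fun t ht => ?_
  rw [← NNReal.coe_le_coe, coe_nnnorm, Real.norm_eq_abs]
  exact (hC t ht x).trans (Real.le_coe_toNNReal C)

theorem exists_pos_le (hu : IsParabolicC2 α (Icc t₀ t₁) u) (hα : 0 < α) (h01 : t₀ ≤ t₁)
    (hpos : ∀ t ∈ Icc t₀ t₁, ∀ x, 0 < u t x) :
    ∃ c, 0 < c ∧ ∀ t ∈ Icc t₀ t₁, ∀ x, c ≤ u t x := by
  rcases isEmpty_or_nonempty S with hS | ⟨⟨x₀⟩⟩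
  · exact ⟨1, one_pos, fun t _ x => isEmptyElim x⟩
  obtain ⟨q, hq, hmin⟩ := (isCompact_Icc.prod isCompact_univ).exists_isMinOn
    ⟨(t₀, x₀), ⟨le_rfl, h01⟩, mem_univ x₀⟩ (hu.continuousOn_uncurry hα h01)
  exact ⟨u q.1 q.2, hpos q.1 hq.1 q.2, fun t ht x => hmin (a := (t, x)) ⟨ht, mem_univ x⟩⟩

end IsParabolicC2

end Regularity

/-! ### The comparison functions -/

/-- A primitive of `t m(t)² / 2` that computes the factor `decay m`. -/
theorem exists_primitive_decay {m : ℝ → ℝ} (hm : ContinuousOn m (Ici 1)) :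
    ∃ A : ℝ → ℝ, (∀ t, 1 ≤ t → HasDerivWithinAt A (t * m t ^ 2 / 2) (Ici 1) t) ∧
      ∀ s, 1 ≤ s → ∀ t, 1 ≤ t → decay m s t = Real.exp (A s - A t) := by
  -- Freezing `m` to the left of `1` makes the integrand continuous on the whole line, so the
  -- primitive is differentiable at the endpoint `1` too.
  set n : ℝ → ℝ := fun t => t * m (max 1 t) ^ 2 / 2 with hn
  have hnc : Continuous n := by
    have : Continuous fun t : ℝ => m (max 1 t) :=
      hm.comp_continuous (by fun_prop) fun t => mem_Ici.mpr (le_max_left _ _)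
    exact (continuous_id.mul (this.pow 2)).div_const 2
  have hnm : ∀ t, 1 ≤ t → n t = t * m t ^ 2 / 2 := fun t ht => by simp only [hn, max_eq_right ht]
  refine ⟨fun t => ∫ τ in (1 : ℝ)..t, n τ, fun t ht => ?_, fun s hs t ht => ?_⟩
  · rw [← hnm t ht]
    exact (intervalIntegral.integral_hasDerivAt_right (hnc.intervalIntegrable _ _)
      (hnc.stronglyMeasurableAtFilter _ _) hnc.continuousAt).hasDerivWithinAt
  · have h1 : ∫ τ in s..t, τ * m τ ^ 2 / 2 = ∫ τ in s..t, n τ :=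
      intervalIntegral.integral_congr fun τ hτ =>
        (hnm τ ((le_min hs ht).trans hτ.1)).symm
    rw [decay, h1, ← intervalIntegral.integral_interval_sub_left
      (hnc.intervalIntegrable 1 t) (hnc.intervalIntegrable 1 s)]
    congr 1
    ring

section Comparison

variable {h m A : ℝ → ℝ} {t₀ t : ℝ}

theorem intervalIntegrable_exp_mul_of_deltaFinite
    (hA : ∀ s, 1 ≤ s → ∀ t, 1 ≤ t → decay m s t = Real.exp (A s - A t)) (ht : 1 ≤ t)
    (hδ : DeltaFinite h m t) :
    IntervalIntegrable (fun s => Real.exp (A s) * (h s / 2)) volume 1 t := by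
  refine (hδ.const_mul (Real.exp (A t))).congr fun s hs => ?_
  rw [uIoc_of_le ht] at hs
  rw [hA s hs.1.le t ht, Real.exp_sub]
  field_simp

theorem delta_eq (hA : ∀ s, 1 ≤ s → ∀ t, 1 ≤ t → decay m s t = Real.exp (A s - A t))
    (ht : 1 ≤ t) :
    delta h m t = (Real.exp (A t) * (t * (1 + t ^ 2)))⁻¹
      * ∫ s in (1 : ℝ)..t, Real.exp (A s) * (h s / 2) := by
  have h1 : ∫ s in (1 : ℝ)..t, h s / 2 * decay m s t
      = ∫ s in (1 : ℝ)..t, (Real.exp (A t))⁻¹ * (Real.exp (A s) * (h s / 2)) := by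
    refine intervalIntegral.integral_congr fun s hs => ?_
    rw [uIcc_of_le ht] at hs
    rw [hA s hs.1 t ht, Real.exp_sub]
    field_simp
  rw [delta, h1, intervalIntegral.integral_const_mul, mul_inv]
  ring

/-- After splitting the integral at `t₀`, the term with `δ(t₀)` cancels the part over `[1, t₀]`. -/
theorem comparison_eq (hA : ∀ s, 1 ≤ s → ∀ t, 1 ≤ t → decay m s t = Real.exp (A s - A t))
    (ht₀ : 1 ≤ t₀) (ht : t₀ ≤ t) (hδ : DeltaFinite h m t) (w : ℝ) :
    delta h m t + t₀ * (1 + t₀ ^ 2) / (t * (1 + t ^ 2)) * (w - delta h m t₀) * decay m t₀ t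
      = (Real.exp (A t) * (t * (1 + t ^ 2)))⁻¹
        * (Real.exp (A t₀) * (t₀ * (1 + t₀ ^ 2)) * w
          + ∫ s in t₀..t, Real.exp (A s) * (h s / 2)) := by
  have ht1 : 1 ≤ t := ht₀.trans ht
  have hint := intervalIntegrable_exp_mul_of_deltaFinite hA ht1 hδ
  have hsplit := intervalIntegral.integral_add_adjacent_intervals
    (hint.mono_set (c := 1) (d := t₀) (by
      rw [uIcc_of_le ht₀, uIcc_of_le ht1]; exact Icc_subset_Icc_right ht))
    (hint.mono_set (c := t₀) (d := t) (by
      rw [uIcc_of_le ht, uIcc_of_le ht1]; exact Icc_subset_Icc_left ht₀))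
  rw [delta_eq hA ht1, delta_eq hA ht₀, hA t₀ ht₀ t ht1, Real.exp_sub, ← hsplit]
  have h0 : 0 < t₀ := by linarith
  have h1 : 0 < t := by linarith
  field_simp
  ring

end Comparison

/-! ### The function `exp(A) t (1 + t²) u⁻²` -/

section Rescaled

variable {A : ℝ → ℝ} {I : Set ℝ} {t : ℝ}

theorem hasDerivWithinAt_rescaled {v : ℝ → ℝ} {a v' : ℝ} (hA : HasDerivWithinAt A a I t)
    (hv : HasDerivWithinAt v v' I t) (hpos : v t ≠ 0) :
    HasDerivWithinAt (fun s => Real.exp (A s) * (s * (1 + s ^ 2)) * v s ^ (-2 : ℤ))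
      (Real.exp (A t) * (a * (t * (1 + t ^ 2)) + (1 + 3 * t ^ 2)) * (v t ^ 2)⁻¹
        - 2 * (Real.exp (A t) * (t * (1 + t ^ 2))) * v' * (v t ^ 3)⁻¹) I t := by
  have h1 : HasDerivWithinAt (fun s : ℝ => s * (1 + s ^ 2)) (1 + 3 * t ^ 2) I t := by
    have := (hasDerivAt_id t).mul (((hasDerivAt_id t).pow 2).const_add 1)
    refine (this.congr_deriv ?_).hasDerivWithinAt
    simp
    ring
  have h2 := ((hasDerivAt_zpow (-2) (v t) (Or.inl hpos)).comp_hasDerivWithinAt t hv)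
  refine ((hA.exp.fun_mul h1).fun_mul h2).congr_deriv ?_
  have e2 : v t ^ (-2 : ℤ) = (v t ^ 2)⁻¹ := by rw [zpow_neg]; norm_cast
  have e3 : v t ^ (-2 - 1 : ℤ) = (v t ^ 3)⁻¹ := by
    rw [show (-2 - 1 : ℤ) = -3 by norm_num, zpow_neg]; norm_cast
  simp only [Function.comp, e2, e3]
  push_cast
  ring

/-- The weight `t (1 + t²)` has derivative `1 + 3 t²`, which cancels that term of the equation. What
remains has a definite sign at an extremum of `u`, apart from the source `F / 2`. -/
theorem rescaled_deriv_eq {E n μ v v' L F : ℝ} (hv : v ≠ 0)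
    (heq : t * (1 + t ^ 2) * v' = v ^ 2 * L / 2 - v ^ 3 / 4 * F
      + v * ((1 + 3 * t ^ 2) / 2 + t ^ 2 * (1 + t ^ 2) * n ^ 2 / 4)) :
    E * (t * μ ^ 2 / 2 * (t * (1 + t ^ 2)) + (1 + 3 * t ^ 2)) * (v ^ 2)⁻¹
        - 2 * (E * (t * (1 + t ^ 2))) * v' * (v ^ 3)⁻¹
      = E * (F / 2 - L / v + t ^ 2 * (1 + t ^ 2) * (μ ^ 2 - n ^ 2) / 2 * (v ^ 2)⁻¹) := by
  have : 2 * (E * (t * (1 + t ^ 2))) * v' = 2 * E * (t * (1 + t ^ 2) * v') := by ring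
  rw [this, heq]
  field_simp
  ring

theorem zpow_neg_two_le_iff {a b : ℝ} (ha : 0 < a) (hb : 0 < b) :
    a ^ (-2 : ℤ) ≤ b ^ (-2 : ℤ) ↔ b ≤ a := by
  have e : ∀ r : ℝ, r ^ (-2 : ℤ) = (r ^ 2)⁻¹ := fun r => by rw [zpow_neg]; norm_cast
  rw [e, e, inv_le_inv₀ (by positivity) (by positivity), pow_le_pow_iff_left₀ hb.le ha.le two_ne_zero]

end Rescaled

theorem compactSpace_of_nonempty_diffeomorph {S : Type*} [TopologicalSpace S]
    [ChartedSpace Plane S] (hS : Nonempty (S ≃ₘ⟮𝓡 2, 𝓡 2⟯ TwoSphere)) : CompactSpace S := by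
  obtain ⟨e⟩ := hS
  have : CompactSpace TwoSphere := isCompact_iff_compactSpace.mp (isCompact_sphere _ _)
  exact e.toHomeomorph.symm.compactSpace

/-! ### Uniform bound for the time derivative of the rescaled function -/

section Bounds

variable {S : Type*} [TopologicalSpace S] [ChartedSpace Plane S] [CompactSpace S]
  {α t₀ t₁ : ℝ} {u : ℝ → S → ℝ} {A m : ℝ → ℝ}

theorem exists_bound_rescaled_deriv (hu : IsParabolicC2 α (Icc t₀ t₁) u) (hα : 0 < α)
    (h01 : t₀ ≤ t₁) (hpos : ∀ t ∈ Icc t₀ t₁, ∀ x, 0 < u t x)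
    (hA : ContinuousOn A (Icc t₀ t₁)) (hm : ContinuousOn m (Icc t₀ t₁)) :
    ∃ C, ∀ t ∈ Icc t₀ t₁, ∀ x,
      |Real.exp (A t) * (t * m t ^ 2 / 2 * (t * (1 + t ^ 2)) + (1 + 3 * t ^ 2)) * (u t x ^ 2)⁻¹
        - 2 * (Real.exp (A t) * (t * (1 + t ^ 2))) * derivWithin (fun s => u s x) (Icc t₀ t₁) t
          * (u t x ^ 3)⁻¹| ≤ C := by
  obtain ⟨c, hc, hcu⟩ := hu.exists_pos_le hα h01 hpos
  obtain ⟨D, hD⟩ := hu.exists_bound_derivWithin hα h01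
  obtain ⟨C₁, hC₁⟩ := isCompact_Icc.exists_bound_of_continuousOn
    (f := fun t => Real.exp (A t) * (t * m t ^ 2 / 2 * (t * (1 + t ^ 2)) + (1 + 3 * t ^ 2)))
    (s := Icc t₀ t₁) (by fun_prop)
  obtain ⟨C₂, hC₂⟩ := isCompact_Icc.exists_bound_of_continuousOn
    (f := fun t => 2 * (Real.exp (A t) * (t * (1 + t ^ 2)))) (s := Icc t₀ t₁) (by fun_prop)
  refine ⟨C₁ * (c ^ 2)⁻¹ + C₂ * D * (c ^ 3)⁻¹, fun t ht x => ?_⟩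
  have h0 := hpos t ht x
  have h1 := hC₁ t ht
  have h2 := hC₂ t ht
  have h3 := hD t ht x
  rw [Real.norm_eq_abs] at h1 h2
  have hC₁0 := (abs_nonneg _).trans h1
  have hC₂0 := (abs_nonneg _).trans h2
  have hD0 := (abs_nonneg _).trans h3
  have hinv : ∀ n : ℕ, |(u t x ^ n)⁻¹| ≤ (c ^ n)⁻¹ := fun n => by
    rw [abs_of_pos (by positivity)]
    exact inv_anti₀ (by positivity) (pow_le_pow_left₀ hc.le (hcu t ht x) n)
  refine (abs_sub _ _).trans (add_le_add ?_ ?_)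
  · rw [abs_mul]
    exact mul_le_mul h1 (hinv 2) (abs_nonneg _) hC₁0
  · rw [abs_mul, abs_mul]
    exact mul_le_mul (mul_le_mul h2 h3 (abs_nonneg _) hC₂0) (hinv 3) (abs_nonneg _)
      (mul_nonneg hC₂0 hD0)

end Bounds

/-! ### The two comparison inequalities -/

section Solution

variable {S : Type*} [TopologicalSpace S] [ChartedSpace Plane S] [IsManifold (𝓡 2) ∞ S]
  [MeasurableSpace S] [CompactSpace S] {g : ℝ → SurfaceMetric S} {f : ℝ → S → ℝ}
  {Rbar : ℝ → S → ℝ} {α t₀ t₁ : ℝ} {u : ℝ → S → ℝ} {h m : ℝ → ℝ}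

theorem comparison_le_of_solvesCurvatureEq (ht₀ : 1 ≤ t₀)
    (hu : IsParabolicC2 α (Icc t₀ t₁) u) (hα : 0 < α)
    (hpos : ∀ t ∈ Icc t₀ t₁, ∀ x, 0 < u t x)
    (hsol : SolvesCurvatureEq g f Rbar (Icc t₀ t₁) u)
    (hm : ContinuousOn m (Ici 1)) (hle : ∀ t, 1 ≤ t → ∀ x, flowNorm (g t) (f t) x ≤ m t)
    (hh : ∀ᵐ s ∂(volume.restrict (Ici (1 : ℝ))), ∀ x,
      h s ≤ scalarCurv (g s) x - s ^ 2 * Rbar s x)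
    (hδ : ∀ t, t₀ ≤ t → DeltaFinite h m t) {b : ℝ} (hb0 : 0 < b) (hb : ∀ x, u t₀ x ≤ b)
    {t : ℝ} (ht : t ∈ Icc t₀ t₁) (x : S) :
    delta h m t + t₀ * (1 + t₀ ^ 2) / (t * (1 + t ^ 2))
      * (b ^ (-2 : ℤ) - delta h m t₀) * decay m t₀ t ≤ u t x ^ (-2 : ℤ) := by
  have h01 : t₀ ≤ t₁ := ht.1.trans ht.2
  have hsub : Icc t₀ t₁ ⊆ Ici 1 := fun s hs => ht₀.trans hs.1
  obtain ⟨A, hAd, hA⟩ := exists_primitive_decay hm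
  have hAd' : ∀ s ∈ Icc t₀ t₁, HasDerivWithinAt A (s * m s ^ 2 / 2) (Icc t₀ t₁) s :=
    fun s hs => (hAd s (hsub hs)).mono hsub
  obtain ⟨C, hC⟩ := exists_bound_rescaled_deriv hu hα h01 hpos
    (fun s hs => (hAd' s hs).continuousWithinAt) (hm.mono hsub)
  have hP : ∀ s ∈ Icc t₀ t₁, 0 < Real.exp (A s) * (s * (1 + s ^ 2)) := fun s hs => by
    have : 0 < s := one_pos.trans_le (hsub hs)
    positivity
  have ht₀I : t₀ ∈ Icc t₀ t₁ := ⟨le_rfl, h01⟩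
  have key := add_integral_le_of_le_deriv_at_min
    (V := fun s y => Real.exp (A s) * (s * (1 + s ^ 2)) * u s y ^ (-2 : ℤ))
    (h := fun s => Real.exp (A s) * (h s / 2))
    (c := Real.exp (A t₀) * (t₀ * (1 + t₀ ^ 2)) * b ^ (-2 : ℤ))
    (fun s hs => continuous_const.mul
      ((hu.contMDiff_space s hs).continuous.zpow₀ _ fun y => Or.inl (hpos s hs y).ne'))
    (fun s hs y => hasDerivWithinAt_rescaled (hAd' s hs)
      (hu.differentiable_time y s hs).hasDerivWithinAt (hpos s hs y).ne') hC
    (fun s hs => (intervalIntegrable_exp_mul_of_deltaFinite hA (hsub hs) (hδ s hs.1)).mono_set (by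
      rw [uIcc_of_le hs.1, uIcc_of_le (hsub hs)]; exact Icc_subset_Icc_left ht₀)) ?_
    (fun y => mul_le_mul_of_nonneg_left
      ((zpow_neg_two_le_iff hb0 (hpos t₀ ht₀I y)).mpr (hb y)) (hP t₀ ht₀I).le) ht x
  · rw [comparison_eq hA ht₀ ht.1 (hδ t ht.1), inv_mul_le_iff₀ (hP t ht)]
    exact key
  · filter_upwards [ae_restrict_of_ae_restrict_of_subset hsub hh,
      ae_restrict_mem measurableSet_Icc] with s hs hsI y hy
    -- `r ↦ r⁻²` is decreasing on positive reals, so a minimum of the rescaled function is a maximum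
    -- of `u`.
    have hmax : ∀ z, u s z ≤ u s y := fun z =>
      (zpow_neg_two_le_iff (hpos s hsI y) (hpos s hsI z)).mp
        (le_of_mul_le_mul_left (hy z) (hP s hsI))
    have hpy := hpos s hsI y
    have hL := laplacian_nonpos_of_isMax (g s) (hu.contMDiff_space s hsI) hmax
    have hn : 0 ≤ m s ^ 2 - flowNorm (g s) (f s) y ^ 2 :=
      sub_nonneg.mpr (pow_le_pow_left₀ (Real.sqrt_nonneg _) (hle s (hsub hsI) y) 2)
    rw [rescaled_deriv_eq hpy.ne' (hsol s hsI y)]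
    refine mul_le_mul_of_nonneg_left ?_ (Real.exp_pos _).le
    have h1 : laplacian (g s) (u s) y / u s y ≤ 0 := div_nonpos_of_nonpos_of_nonneg hL hpy.le
    have h2 : 0 ≤ s ^ 2 * (1 + s ^ 2) * (m s ^ 2 - flowNorm (g s) (f s) y ^ 2) / 2
        * (u s y ^ 2)⁻¹ := by positivity
    linarith [hs y]

theorem le_comparison_of_solvesCurvatureEq (ht₀ : 1 ≤ t₀)
    (hu : IsParabolicC2 α (Icc t₀ t₁) u) (hα : 0 < α)
    (hpos : ∀ t ∈ Icc t₀ t₁, ∀ x, 0 < u t x)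
    (hsol : SolvesCurvatureEq g f Rbar (Icc t₀ t₁) u)
    (hm : ContinuousOn m (Ici 1)) (hm0 : ∀ t, 1 ≤ t → 0 ≤ m t)
    (hle : ∀ t, 1 ≤ t → ∀ x, m t ≤ flowNorm (g t) (f t) x)
    (hh : ∀ᵐ s ∂(volume.restrict (Ici (1 : ℝ))), ∀ x,
      scalarCurv (g s) x - s ^ 2 * Rbar s x ≤ h s)
    (hδ : ∀ t, t₀ ≤ t → DeltaFinite h m t) {b : ℝ} (hb0 : 0 < b) (hb : ∀ x, b ≤ u t₀ x)
    {t : ℝ} (ht : t ∈ Icc t₀ t₁) (x : S) :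
    u t x ^ (-2 : ℤ) ≤ delta h m t + t₀ * (1 + t₀ ^ 2) / (t * (1 + t ^ 2))
      * (b ^ (-2 : ℤ) - delta h m t₀) * decay m t₀ t := by
  have h01 : t₀ ≤ t₁ := ht.1.trans ht.2
  have hsub : Icc t₀ t₁ ⊆ Ici 1 := fun s hs => ht₀.trans hs.1
  obtain ⟨A, hAd, hA⟩ := exists_primitive_decay hm
  have hAd' : ∀ s ∈ Icc t₀ t₁, HasDerivWithinAt A (s * m s ^ 2 / 2) (Icc t₀ t₁) s :=
    fun s hs => (hAd s (hsub hs)).mono hsub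
  obtain ⟨C, hC⟩ := exists_bound_rescaled_deriv hu hα h01 hpos
    (fun s hs => (hAd' s hs).continuousWithinAt) (hm.mono hsub)
  have hP : ∀ s ∈ Icc t₀ t₁, 0 < Real.exp (A s) * (s * (1 + s ^ 2)) := fun s hs => by
    have : 0 < s := one_pos.trans_le (hsub hs)
    positivity
  have ht₀I : t₀ ∈ Icc t₀ t₁ := ⟨le_rfl, h01⟩
  have key := le_add_integral_of_deriv_at_max_le
    (V := fun s y => Real.exp (A s) * (s * (1 + s ^ 2)) * u s y ^ (-2 : ℤ))
    (h := fun s => Real.exp (A s) * (h s / 2))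
    (c := Real.exp (A t₀) * (t₀ * (1 + t₀ ^ 2)) * b ^ (-2 : ℤ))
    (fun s hs => continuous_const.mul
      ((hu.contMDiff_space s hs).continuous.zpow₀ _ fun y => Or.inl (hpos s hs y).ne'))
    (fun s hs y => hasDerivWithinAt_rescaled (hAd' s hs)
      (hu.differentiable_time y s hs).hasDerivWithinAt (hpos s hs y).ne') hC
    (fun s hs => (intervalIntegrable_exp_mul_of_deltaFinite hA (hsub hs) (hδ s hs.1)).mono_set (by
      rw [uIcc_of_le hs.1, uIcc_of_le (hsub hs)]; exact Icc_subset_Icc_left ht₀)) ?_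
    (fun y => mul_le_mul_of_nonneg_left
      ((zpow_neg_two_le_iff (hpos t₀ ht₀I y) hb0).mpr (hb y)) (hP t₀ ht₀I).le) ht x
  · rw [comparison_eq hA ht₀ ht.1 (hδ t ht.1), le_inv_mul_iff₀ (hP t ht)]
    exact key
  · filter_upwards [ae_restrict_of_ae_restrict_of_subset hsub hh,
      ae_restrict_mem measurableSet_Icc] with s hs hsI y hy
    have hmin : ∀ z, u s y ≤ u s z := fun z =>
      (zpow_neg_two_le_iff (hpos s hsI z) (hpos s hsI y)).mp
        (le_of_mul_le_mul_left (hy z) (hP s hsI))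
    have hpy := hpos s hsI y
    have hL := laplacian_nonneg_of_isMin (g s) (hu.contMDiff_space s hsI) hmin
    have hn : 0 ≤ flowNorm (g s) (f s) y ^ 2 - m s ^ 2 :=
      sub_nonneg.mpr (pow_le_pow_left₀ (hm0 s (hsub hsI)) (hle s (hsub hsI) y) 2)
    rw [rescaled_deriv_eq hpy.ne' (hsol s hsI y)]
    refine mul_le_mul_of_nonneg_left ?_ (Real.exp_pos _).le
    have h1 : 0 ≤ laplacian (g s) (u s) y / u s y := div_nonneg hL hpy.le
    have h2 : 0 ≤ s ^ 2 * (1 + s ^ 2) * (flowNorm (g s) (f s) y ^ 2 - m s ^ 2) / 2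
        * (u s y ^ 2)⁻¹ := by positivity
    have h3 : s ^ 2 * (1 + s ^ 2) * (m s ^ 2 - flowNorm (g s) (f s) y ^ 2) / 2 * (u s y ^ 2)⁻¹
        = -(s ^ 2 * (1 + s ^ 2) * (flowNorm (g s) (f s) y ^ 2 - m s ^ 2) / 2
          * (u s y ^ 2)⁻¹) := by ring
    linarith [hs y]

end Solution

end RicciFoliation

end

open RicciFoliation in
theorem proposition4
    {S : Type*} [TopologicalSpace S] [ChartedSpace Plane S] [IsManifold (𝓡 2) ∞ S]
    [MeasurableSpace S] [BorelSpace S]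
    (hS : Nonempty (S ≃ₘ⟮𝓡 2, 𝓡 2⟯ TwoSphere))
    (g : ℝ → SurfaceMetric S) (f : ℝ → S → ℝ)
    (harea : areaMeasure (g 1) univ = ENNReal.ofReal (4 * Real.pi))
    (hflow : IsModifiedRicciFlow g f)
    (Rbar : ℝ → S → ℝ) (F m : ℝ → S → ℝ)
    (hF : F = fun t x => scalarCurv (g t) x - t ^ 2 * Rbar t x)
    (hm : m = fun t x => flowNorm (g t) (f t) x)
    (α t₀ t₁ : ℝ) (hα₀ : 0 < α) (hα₁ : α < 1) (ht₀ : 1 ≤ t₀) (ht₁ : t₀ < t₁)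
    (u : ℝ → S → ℝ)
    (hu : IsParabolicC2 α (Icc t₀ t₁) u)
    (hpos : ∀ t ∈ Icc t₀ t₁, ∀ x, 0 < u t x)
    (hsol : SolvesCurvatureEq g f Rbar (Icc t₀ t₁) u)
    -- `δ_*` and `δ^*` are defined and finite: the infimum and the supremum are finite for
    -- almost every `s ≥ 1`, and the integrals converge
    (hbelow : ∀ᵐ s ∂(volume.restrict (Ici (1 : ℝ))), BddBelow (range (F s)))
    (habove : ∀ᵐ s ∂(volume.restrict (Ici (1 : ℝ))), BddAbove (range (F s)))
    (hδlower : ∀ t, t₀ ≤ t → DeltaFinite (lowerEnv F) (upperEnv m) t)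
    (hδupper : ∀ t, t₀ ≤ t → DeltaFinite (upperEnv F) (lowerEnv m) t) :
    ∀ t ∈ Icc t₀ t₁, ∀ x : S,
      delta (lowerEnv F) (upperEnv m) t
          + t₀ * (1 + t₀ ^ 2) / (t * (1 + t ^ 2))
            * (upperEnv u t₀ ^ (-2 : ℤ) - delta (lowerEnv F) (upperEnv m) t₀)
            * decay (upperEnv m) t₀ t
        ≤ u t x ^ (-2 : ℤ)
      ∧ u t x ^ (-2 : ℤ)
        ≤ delta (upperEnv F) (lowerEnv m) t
          + t₀ * (1 + t₀ ^ 2) / (t * (1 + t ^ 2))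
            * (lowerEnv u t₀ ^ (-2 : ℤ) - delta (upperEnv F) (lowerEnv m) t₀)
            * decay (lowerEnv m) t₀ t := by
  subst hF hm
  have hcomp : CompactSpace S := compactSpace_of_nonempty_diffeomorph hS
  intro t ht x
  have hne : Nonempty S := ⟨x⟩
  have hmc : ContinuousOn (Function.uncurry fun t x => flowNorm (g t) (f t) x) (Ici 1 ×ˢ univ) :=
    hflow.continuousOn_flowNorm
  have hmt : ∀ t, 1 ≤ t → Continuous (flowNorm (g t) (f t)) := fun t ht =>
    hmc.comp_continuous (f := fun x => (t, x)) (by fun_prop) fun x => ⟨ht, mem_univ x⟩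
  have hut : Continuous (u t₀) := (hu.contMDiff_space t₀ ⟨le_rfl, ht₁.le⟩).continuous
  have hup := hpos t₀ ⟨le_rfl, ht₁.le⟩
  have hub := (isCompact_range hut).bddAbove
  have hlb := (isCompact_range hut).bddBelow
  -- The infimum is attained by compactness, hence is a positive value of `u`.
  have hb0 : 0 < lowerEnv u t₀ := by
    obtain ⟨y, hy⟩ := (isCompact_range hut).sInf_mem (range_nonempty _)
    exact (hup y).trans_eq hy
  constructor
  · refine comparison_le_of_solvesCurvatureEq ht₀ hu hα₀ hpos hsol (continuousOn_upperEnv hmc)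
      (fun s hs y => le_ciSup (isCompact_range (hmt s hs)).bddAbove y) ?_ hδlower
      ((hup x).trans_le (le_ciSup hub x)) (fun y => le_ciSup hub y) ht x
    filter_upwards [hbelow] with s hs y using ciInf_le hs y
  · refine le_comparison_of_solvesCurvatureEq ht₀ hu hα₀ hpos hsol (continuousOn_lowerEnv hmc)
      (fun s _ => Real.iInf_nonneg fun y => Real.sqrt_nonneg _)
      (fun s hs y => ciInf_le (isCompact_range (hmt s hs)).bddBelow y) ?_ hδupper
      hb0 (fun y => ciInf_le hlb y) ht x
    filter_upwards [habove] with s hs y using le_ciSup hs y
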